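/- Let $\Sigma_1,\dots,\Sigma_n$ be symmetric positive definite real $d\times d$ matrices, let $\langle X,Y\rangle=\operatorname{tr}(XY^\top)$ with Frobenius norm $\|\cdot\|$, let $\pi(A)=AA^\top$ for $A\in GL_d$, and let $BW_2^2(\Sigma,\Sigma')=\operatorname{tr}\big[\Sigma+\Sigma'-2(\Sigma^{1/2}\Sigma'\Sigma^{1/2})^{1/2}\big]$ on the set $S_d^{++}$ of symmetric positive definite matrices. Fix a margin $\varepsilon\ge 0$. For $A\in GL_d$ and $X$ with $X^\top A=A^\top X$ (that is, $X$ horizontal at $A$) and $\|X\|=1$, let $J_\varepsilon(A,X)\subset\mathbb R$ be the closed, possibly unbounded, interval of all $t$ such that $-1/\lambda+\varepsilon\le t$ for every eigenvalue $\lambda>0$ of $XA^{-1}$ and $t\le -1/\lambda-\varepsilon$ for every eigenvalue $\lambda<0$ of $XA^{-1}$; for $\varepsilon>0$ the matrix $A+tX$ is invertible for every $t\in J_\varepsilon(A,X)$, while $J_0(A,X)$ is the closure of the largest interval around $0$ on which $A+tX$ is invertible. If $J_\varepsilon(A,X)\neq\emptyset$, let $p_{A,X}$ be the clipping of real numbers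 onto $J_\varepsilon(A,X)$. The lifted problem is to minimize $$F(A,X,(Q_i)_{i=1}^n)=\sum_{i=1}^n\big\|A+p_{A,X}(t_i)X-\Sigma_i^{1/2}Q_i\big\|^2,\qquad t_i=\langle\Sigma_i^{1/2}Q_i-A,X\rangle,$$ over $A\in GL_d$, $X$ horizontal at $A$ with $\|X\|=1$ and $J_\varepsilon(A,X)\ne\emptyset$, and $Q_1,\dots,Q_n\in SO_d$. A (unit speed) geodesic is a curve $\Sigma:I\to S_d^{++}$ on a nonempty interval $I\subseteq\mathbb R$ with $BW_2(\Sigma(s),\Sigma(t))=|s-t|$ for all $s,t\in I$. The first-component geodesic PCA problem is to minimize $$\sum_{i=1}^n\inf_{t\in I}BW_2^2(\Sigma(t),\Sigma_i)$$ over all intervals $I$ and all geodesics $\Sigma:I\to S_d^{++}$ that extend to a geodesic in $S_d^{++}$ on $I\cup\{t:\ |t-s|<\varepsilon\text{ for some }s\in I\}$ (for $\varepsilon=0$: over all geodesics). Let $(A_1,X_1,(Q_i)_{i=1}^n)$ be a solution of the lifted problem. Then: (a) The curve $t\mapsto\pi(A_1+tX_1)$ on $\{t\in J_\varepsilon(A_1,X_1):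 A_1+tX_1\in GL_d\}$ (which is $J_\varepsilon(A_1,X_1)$ itself if $\varepsilon>0$) is a geodesic that solves the geodesic PCA problem. (b) If $\varepsilon>0$, or if $\varepsilon=0$ and $A_1+p_{A_1,X_1}(t_i)X_1$ is invertible for every $i$, then there exist real numbers $t_{\min}\le t_{\max}$ such that $[t_{\min},t_{\max}]\subseteq J_\varepsilon(A_1,X_1)$ contains all the clipped times $p_{A_1,X_1}(t_i)$, the matrix $A_1+tX_1$ is invertible for all $t\in[t_{\min},t_{\max}]$, and the curve $t\mapsto\pi(A_1+tX_1)$ on $[t_{\min},t_{\max}]$ is a geodesic that solves the geodesic PCA problem. -/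

import Mathlib

namespace GaussianGPCA

/-- The Frobenius inner product `⟨X, Y⟩ = tr (X Yᵀ)`. -/
noncomputable def frobInner {d : ℕ} (X Y : Matrix (Fin d) (Fin d) ℝ) : ℝ :=
  (X * Y.transpose).trace

/-- The squared Frobenius norm `‖X‖²`. -/
noncomputable def frobSq {d : ℕ} (X : Matrix (Fin d) (Fin d) ℝ) : ℝ :=
  frobInner X X

open scoped MatrixOrder in
/-- The positive semidefinite square root `S^{1/2}` of a positive semidefinite matrix `S`. -/
noncomputable def matSqrt {d : ℕ} (S : Matrix (Fin d) (Fin d) ℝ) : Matrix (Fin d) (Fin d) ℝ :=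
  CFC.sqrt S

/-- The Bures-Wasserstein distance between symmetric positive definite matrices,
`BW₂² (S, T) = tr (S + T - 2 (S^{1/2} T S^{1/2})^{1/2})`. -/
noncomputable def bw {d : ℕ} (S T : Matrix (Fin d) (Fin d) ℝ) : ℝ :=
  Real.sqrt ((S + T - (2 : ℝ) • matSqrt (matSqrt S * T * matSqrt S)).trace)

/-- The projection `π (A) = A Aᵀ`. -/
def proj {d : ℕ} (A : Matrix (Fin d) (Fin d) ℝ) : Matrix (Fin d) (Fin d) ℝ :=
  A * A.transpose

/-- `X` is horizontal at `A`. -/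
def IsHorizontal {d : ℕ} (A X : Matrix (Fin d) (Fin d) ℝ) : Prop :=
  X.transpose * A - A.transpose * X = 0

/-- The closed interval of times `t` with `-1/μ + ε ≤ t` for all positive eigenvalues `μ` of
`X A⁻¹` and `t ≤ -1/μ - ε` for all negative ones. For `A` invertible and `X` horizontal at `A`
these are the times that keep distance at least `ε` from both ends of the largest interval around
`0` on which `A + t X` is invertible. It may be unbounded. -/
def clipInterval {d : ℕ} (ε : ℝ) (A X : Matrix (Fin d) (Fin d) ℝ) : Set ℝ :=
  {t | ∀ μ ∈ spectrum ℝ (X * A⁻¹),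
    (0 < μ → -1 / μ + ε ≤ t) ∧ (μ < 0 → t ≤ -1 / μ - ε)}

open scoped Classical in
/-- Clipping of `t` onto a nonempty closed interval `J`. -/
noncomputable def clip (J : Set ℝ) (t : ℝ) : ℝ :=
  if t ∈ J then t else if ∀ r ∈ J, t < r then sInf J else sSup J

/-- The clipped projection time `p_{A,X} (⟨S^{1/2} Q - A, X⟩)`. -/
noncomputable def clippedTime {d : ℕ} (ε : ℝ) (S A X Q : Matrix (Fin d) (Fin d) ℝ) : ℝ :=
  clip (clipInterval ε A X) (frobInner (matSqrt S * Q - A) X)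

/-- The lifted cost `F (A, X, (Q_i))`. -/
noncomputable def liftedCost {d n : ℕ} (ε : ℝ) (S : Fin n → Matrix (Fin d) (Fin d) ℝ)
    (A X : Matrix (Fin d) (Fin d) ℝ) (Q : Fin n → Matrix (Fin d) (Fin d) ℝ) : ℝ :=
  ∑ i, frobSq (A + clippedTime ε (S i) A X (Q i) • X - matSqrt (S i) * Q i)

/-- The constraints of the lifted problem. The last one says that there is an interval to clip to;
the clipping is meaningless without it. -/
def IsLiftedFeasible {d n : ℕ} (ε : ℝ) (A X : Matrix (Fin d) (Fin d) ℝ)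
    (Q : Fin n → Matrix (Fin d) (Fin d) ℝ) : Prop :=
  IsUnit A ∧ IsHorizontal A X ∧ frobSq X = 1 ∧
    (∀ i, Q i ∈ Matrix.specialOrthogonalGroup (Fin d) ℝ) ∧ (clipInterval ε A X).Nonempty

/-- `(A, X, (Q_i))` is a solution of the lifted problem. -/
def IsLiftedSolution {d n : ℕ} (ε : ℝ) (S : Fin n → Matrix (Fin d) (Fin d) ℝ)
    (A X : Matrix (Fin d) (Fin d) ℝ) (Q : Fin n → Matrix (Fin d) (Fin d) ℝ) : Prop :=
  IsLiftedFeasible ε A X Q ∧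
    ∀ (A' X' : Matrix (Fin d) (Fin d) ℝ) (Q' : Fin n → Matrix (Fin d) (Fin d) ℝ),
      IsLiftedFeasible ε A' X' Q' → liftedCost ε S A X Q ≤ liftedCost ε S A' X' Q'

/-- On the nonempty interval `I` the curve `γ` is a unit speed geodesic of the space of symmetric
positive definite matrices with the Bures-Wasserstein distance. -/
def IsBWGeodesicOn {d : ℕ} (γ : ℝ → Matrix (Fin d) (Fin d) ℝ) (I : Set ℝ) : Prop :=
  I.Nonempty ∧ I.OrdConnected ∧ (∀ t ∈ I, (γ t).PosDef) ∧
    ∀ s ∈ I, ∀ t ∈ I, bw (γ s) (γ t) = |s - t|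

/-- `γ` restricted to `I` is a unit speed geodesic which can be continued as a unit speed geodesic
of symmetric positive definite matrices by length `ε` (excluded) beyond every point of `I`.
For `ε = 0` this is just `IsBWGeodesicOn γ I`. -/
def IsAdmissible {d : ℕ} (ε : ℝ) (γ : ℝ → Matrix (Fin d) (Fin d) ℝ) (I : Set ℝ) : Prop :=
  IsBWGeodesicOn γ I ∧ ∃ γ' : ℝ → Matrix (Fin d) (Fin d) ℝ, Set.EqOn γ γ' I ∧
    IsBWGeodesicOn γ' (I ∪ Metric.thickening ε I)

/-- The geodesic PCA cost `∑ i, inf_{t ∈ I} BW₂² (γ (t), S_i)` of a curve `γ` on `I`. -/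
noncomputable def gpcaCost {d n : ℕ} (S : Fin n → Matrix (Fin d) (Fin d) ℝ)
    (γ : ℝ → Matrix (Fin d) (Fin d) ℝ) (I : Set ℝ) : ℝ :=
  ∑ i, ⨅ t : I, bw (γ t) (S i) ^ 2

/-- `γ` on `I` is an admissible geodesic which minimizes the geodesic PCA cost among all
admissible geodesics on all intervals. -/
def IsGPCASolution {d n : ℕ} (ε : ℝ) (S : Fin n → Matrix (Fin d) (Fin d) ℝ)
    (γ : ℝ → Matrix (Fin d) (Fin d) ℝ) (I : Set ℝ) : Prop :=
  IsAdmissible ε γ I ∧ ∀ (γ' : ℝ → Matrix (Fin d) (Fin d) ℝ) (I' : Set ℝ),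
    IsAdmissible ε γ' I' → gpcaCost S γ I ≤ gpcaCost S γ' I'

end GaussianGPCA

namespace GaussianGPCA

open Matrix

variable {d n : ℕ}

/-! For an invertible `B`, every positive definite `S` has exactly one lift `C` with `Bᵀ * C`
positive definite. It realizes the Bures-Wasserstein distance as `‖B - C‖`, and no other lift is
closer (`bw_sq_eq_frobSq`, `exists_optimal_lift`, `bw_sq_le_frobSq`, `eq_of_optimal_lift`). Together
with the equality case of the triangle inequality, this makes every geodesic the image of a
horizontal line (`exists_line_of_isBWGeodesicOn`).

Hence an admissible geodesic with any choice of times on it gives a feasible lifted point of no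
larger cost (`exists_isLiftedFeasible`), and the lifted minimum is at most the cost of every
admissible geodesic (`IsLiftedSolution.le_gpcaCost`). Conversely, Frobenius distances between lifts
dominate distances in the base, so the line of a lifted minimizer costs at most the lifted minimum
on any admissible time interval whose closure contains the clipped times
(`IsLiftedSolution.isGPCASolution`).

The line is controlled by the symmetric matrix `M = X * A⁻¹`: `A + t • X = (1 + t • M) * A`, and
positivity of `1 + t • M` amounts to the scalar inequalities `0 < 1 + t * μ` over the spectrum,
which the clipping interval encodes with a margin. -/

/-! ### Frobenius geometry. -/

theorem frobInner_comm (X Y : Matrix (Fin d) (Fin d) ℝ) : frobInner X Y = frobInner Y X := by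
  unfold frobInner
  rw [← trace_transpose, transpose_mul, transpose_transpose]

theorem frobInner_add_left (X Y Z : Matrix (Fin d) (Fin d) ℝ) :
    frobInner (X + Y) Z = frobInner X Z + frobInner Y Z := by
  simp [frobInner, add_mul]

theorem frobInner_sub_left (X Y Z : Matrix (Fin d) (Fin d) ℝ) :
    frobInner (X - Y) Z = frobInner X Z - frobInner Y Z := by
  simp [frobInner, sub_mul]

theorem frobInner_smul_left (a : ℝ) (X Y : Matrix (Fin d) (Fin d) ℝ) :
    frobInner (a • X) Y = a * frobInner X Y := by
  simp [frobInner]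

theorem frobInner_add_right (X Y Z : Matrix (Fin d) (Fin d) ℝ) :
    frobInner X (Y + Z) = frobInner X Y + frobInner X Z := by
  simp [frobInner, mul_add]

theorem frobInner_sub_right (X Y Z : Matrix (Fin d) (Fin d) ℝ) :
    frobInner X (Y - Z) = frobInner X Y - frobInner X Z := by
  simp [frobInner, mul_sub]

theorem frobInner_smul_right (a : ℝ) (X Y : Matrix (Fin d) (Fin d) ℝ) :
    frobInner X (a • Y) = a * frobInner X Y := by
  simp [frobInner]

theorem frobSq_nonneg (X : Matrix (Fin d) (Fin d) ℝ) : 0 ≤ frobSq X := by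
  have := (posSemidef_self_mul_conjTranspose X).trace_nonneg
  rwa [conjTranspose_eq_transpose_of_trivial] at this

theorem frobSq_eq_zero {X : Matrix (Fin d) (Fin d) ℝ} (h : frobSq X = 0) : X = 0 := by
  rw [← trace_mul_conjTranspose_self_eq_zero_iff, conjTranspose_eq_transpose_of_trivial]
  exact h

theorem frobSq_smul (a : ℝ) (X : Matrix (Fin d) (Fin d) ℝ) :
    frobSq (a • X) = a ^ 2 * frobSq X := by
  simp only [frobSq, frobInner_smul_left, frobInner_smul_right]
  ring

theorem frobSq_sub_comm (X Y : Matrix (Fin d) (Fin d) ℝ) :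
    frobSq (X - Y) = frobSq (Y - X) := by
  rw [← neg_sub, ← neg_one_smul ℝ, frobSq_smul]
  ring

/-- The squared distance to a line is a quadratic polynomial in the time, minimal at the
projection time. -/
theorem frobSq_line_sub (A X Y : Matrix (Fin d) (Fin d) ℝ) (hX : frobSq X = 1) (t : ℝ) :
    frobSq (A + t • X - Y) =
      (t - frobInner (Y - A) X) ^ 2 + (frobSq (A - Y) - frobInner (Y - A) X ^ 2) := by
  have h1 := frobInner_comm X Y
  have h2 := frobInner_comm X A
  simp only [frobSq, frobInner_smul_left, frobInner_smul_right, frobInner_add_left,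
    frobInner_add_right, frobInner_sub_left, frobInner_sub_right] at *
  rw [h1, h2, hX]
  ring

/-- The equality case of the triangle inequality. -/
theorem smul_eq_smul_of_triangle {u v : Matrix (Fin d) (Fin d) ℝ} {a b : ℝ} (ha : 0 ≤ a)
    (hb : 0 ≤ b) (hu : frobSq u = a ^ 2) (hv : frobSq v = b ^ 2)
    (huv : (a + b) ^ 2 ≤ frobSq (u + v)) : b • u = a • v := by
  have h0 := frobInner_comm v u
  have h1 : a * b ≤ frobInner u v := by
    simp only [frobSq, frobInner_add_left, frobInner_add_right] at *
    linarith [hu, hv, huv, h0]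
  have h2 : frobSq (b • u - a • v) = 2 * (a * b) * (a * b - frobInner u v) := by
    simp only [frobSq, frobInner_smul_left, frobInner_smul_right, frobInner_sub_left,
      frobInner_sub_right] at *
    rw [hu, hv, h0]
    ring
  have h3 := frobSq_nonneg (b • u - a • v)
  have h4 : 2 * (a * b) * (a * b - frobInner u v) ≤ 0 :=
    mul_nonpos_of_nonneg_of_nonpos (by positivity) (by linarith)
  exact sub_eq_zero.1 (frobSq_eq_zero (le_antisymm (h2 ▸ h4) h3))

/-! ### Square roots, fibres of the projection and optimal lifts. -/

theorem posDef_proj {A : Matrix (Fin d) (Fin d) ℝ} (hA : IsUnit A) : (proj A).PosDef := by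
  have := (IsUnit.posDef_star_right_conjugate_iff (x := (1 : Matrix (Fin d) (Fin d) ℝ)) hA).2
    PosDef.one
  simpa [proj, star_eq_conjTranspose] using this

theorem isUnit_of_posDef_proj {A : Matrix (Fin d) (Fin d) ℝ} (h : (proj A).PosDef) :
    IsUnit A := by
  rw [isUnit_iff_isUnit_det]
  have := (isUnit_iff_isUnit_det _).1 h.isUnit
  rw [proj, det_mul] at this
  exact isUnit_of_mul_isUnit_left this

open scoped MatrixOrder in
theorem matSqrt_eq_of_mul_self {S R : Matrix (Fin d) (Fin d) ℝ} (h : R * R = S)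
    (hR : R.PosSemidef) : matSqrt S = R :=
  CFC.sqrt_unique h hR.nonneg

open scoped MatrixOrder in
theorem matSqrt_mul_self {S : Matrix (Fin d) (Fin d) ℝ} (hS : S.PosDef) :
    matSqrt S * matSqrt S = S :=
  CFC.sqrt_mul_sqrt_self S hS.posSemidef.nonneg

open scoped MatrixOrder in
theorem posDef_matSqrt {S : Matrix (Fin d) (Fin d) ℝ} (hS : S.PosDef) :
    (matSqrt S).PosDef := by
  have h : (matSqrt S).PosSemidef := nonneg_iff_posSemidef.1 (CFC.sqrt_nonneg S)
  refine h.posDef_iff_isUnit.2 ?_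
  have h1 := hS.isUnit
  rw [← matSqrt_mul_self hS, isUnit_iff_isUnit_det, det_mul] at h1
  rw [isUnit_iff_isUnit_det]
  exact isUnit_of_mul_isUnit_left h1

theorem PosDef.transpose_eq {S : Matrix (Fin d) (Fin d) ℝ} (hS : S.PosDef) : Sᵀ = S := by
  have := hS.isHermitian.eq
  rwa [conjTranspose_eq_transpose_of_trivial] at this

theorem proj_matSqrt {S : Matrix (Fin d) (Fin d) ℝ} (hS : S.PosDef) : proj (matSqrt S) = S := by
  rw [proj, PosDef.transpose_eq (posDef_matSqrt hS), matSqrt_mul_self hS]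

theorem posDef_conj {P B : Matrix (Fin d) (Fin d) ℝ} (hP : P.PosDef) (hB : IsUnit B) :
    (B * P * Bᵀ).PosDef := by
  have := (IsUnit.posDef_star_right_conjugate_iff (x := P) hB).2 hP
  simpa [star_eq_conjTranspose] using this

/-- Matrices over the same point of the base differ by an orthogonal factor. -/
theorem exists_orthogonal_of_proj_eq {C D : Matrix (Fin d) (Fin d) ℝ} (hC : IsUnit C)
    (h : proj D = proj C) : ∃ U, D = C * U ∧ U * Uᵀ = 1 := by
  have hC' := (isUnit_iff_isUnit_det C).1 hC
  refine ⟨C⁻¹ * D, by rw [mul_nonsing_inv_cancel_left _ _ hC'], ?_⟩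
  have hCt : IsUnit (Cᵀ).det := by rwa [det_transpose]
  unfold proj at h
  rw [transpose_mul, Matrix.mul_assoc, ← Matrix.mul_assoc D, h, transpose_nonsing_inv,
    Matrix.mul_assoc, mul_nonsing_inv _ hCt, Matrix.mul_one, nonsing_inv_mul _ hC']

/-- Distances to the other points of a fibre from a point in optimal position. -/
theorem frobSq_sub_mul_orthogonal {B C U : Matrix (Fin d) (Fin d) ℝ} (hP : (Bᵀ * C).PosDef)
    (hU : U * Uᵀ = 1) :
    frobSq (B - C * U) = frobSq (B - C) + frobSq ((1 - U)ᵀ * matSqrt (Bᵀ * C)) := by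
  have hR := matSqrt_mul_self hP
  have hRt := PosDef.transpose_eq (posDef_matSqrt hP)
  have hPt := PosDef.transpose_eq hP
  set R := matSqrt (Bᵀ * C)
  have h1 : frobSq ((1 - U)ᵀ * R) = ((1 - U) * (1 - U)ᵀ * (Bᵀ * C)).trace := by
    unfold frobSq frobInner
    rw [transpose_mul, hRt, transpose_transpose, Matrix.mul_assoc, ← Matrix.mul_assoc R, hR,
      trace_mul_comm, Matrix.mul_assoc, trace_mul_comm (Bᵀ * C)]
  have h2 : (1 - U) * (1 - U)ᵀ = (2 : ℝ) • 1 - U - Uᵀ := by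
    rw [transpose_sub, transpose_one, Matrix.sub_mul, Matrix.mul_sub, Matrix.mul_sub, hU, two_smul]
    simp only [Matrix.one_mul, Matrix.mul_one]
    abel
  have h3 : (Uᵀ * (Bᵀ * C)).trace = (U * (Bᵀ * C)).trace := by
    rw [← trace_transpose, transpose_mul, hPt, transpose_transpose, trace_mul_comm]
  have h4 : frobInner B (C * U) = (U * (Bᵀ * C)).trace := by
    rw [frobInner_comm, frobInner, trace_mul_comm, ← Matrix.mul_assoc, trace_mul_comm]
  have h5 : frobInner B C = (Bᵀ * C).trace := by
    rw [frobInner_comm, frobInner, trace_mul_comm]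
  have h6 : frobInner (C * U) (C * U) = frobInner C C := by
    unfold frobInner
    rw [transpose_mul, Matrix.mul_assoc, ← Matrix.mul_assoc U, hU, Matrix.one_mul]
  rw [h1, h2]
  simp only [Matrix.sub_mul, trace_sub, Matrix.smul_mul, trace_smul, Matrix.one_mul, h3, frobSq,
    frobInner_sub_left, frobInner_sub_right, h6, frobInner_comm (C * U) B, h4,
    frobInner_comm C B, h5, smul_eq_mul]
  ring

/-- The root of `proj B` is `B * V` with `V` orthogonal, which conjugates the inner root in `bw` to
`Bᵀ * C`; its trace is `⟨B, C⟩`. -/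
theorem bw_sq_eq_frobSq {B C : Matrix (Fin d) (Fin d) ℝ} (hB : IsUnit B)
    (hP : (Bᵀ * C).PosDef) : bw (proj B) (proj C) ^ 2 = frobSq (B - C) := by
  have hS := posDef_proj hB
  have hPt := PosDef.transpose_eq hP
  have hR := proj_matSqrt hS
  have hRt := PosDef.transpose_eq (posDef_matSqrt hS)
  set R := matSqrt (proj B)
  obtain ⟨V, hV, hVV⟩ := exists_orthogonal_of_proj_eq hB hR
  have hVV' : Vᵀ * V = 1 := mul_eq_one_comm.1 hVV
  have hV2 : R = Vᵀ * Bᵀ := by rw [← hRt, hV, transpose_mul]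
  have hVu : IsUnit Vᵀ := IsUnit.of_mul_eq_one _ hVV'
  have hsq : matSqrt (R * proj C * R) = Vᵀ * (Bᵀ * C) * Vᵀᵀ := by
    refine matSqrt_eq_of_mul_self ?_ (posDef_conj hP hVu).posSemidef
    have e : R * proj C * R = (Vᵀ * Bᵀ) * proj C * (B * V) := by rw [← hV2, ← hV]
    have e2 : (Bᵀ * C) = Cᵀ * B := by rw [← hPt, transpose_mul, transpose_transpose]
    rw [e, proj, transpose_transpose]
    calc Vᵀ * (Bᵀ * C) * V * (Vᵀ * (Bᵀ * C) * V)
        = Vᵀ * (Bᵀ * C) * (V * Vᵀ) * (Bᵀ * C) * V := by simp only [Matrix.mul_assoc]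
      _ = Vᵀ * (Bᵀ * C) * (Cᵀ * B) * V := by rw [hVV, Matrix.mul_one, ← e2]
      _ = _ := by simp only [Matrix.mul_assoc]
  have htr : (Vᵀ * (Bᵀ * C) * Vᵀᵀ).trace = frobInner B C := by
    rw [trace_mul_comm, transpose_transpose, ← Matrix.mul_assoc, hVV, Matrix.one_mul,
      frobInner_comm, frobInner, trace_mul_comm]
  have key : (proj B + proj C - (2 : ℝ) • matSqrt (R * proj C * R)).trace = frobSq (B - C) := by
    rw [hsq, trace_sub, trace_add, trace_smul, htr]
    simp only [frobSq, frobInner_sub_left, frobInner_sub_right, frobInner_comm C B, smul_eq_mul]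
    unfold frobInner proj
    ring
  unfold bw
  rw [key, Real.sq_sqrt (frobSq_nonneg _)]

/-- Every point of the base has a lift in optimal position to a given invertible matrix. -/
theorem exists_optimal_lift {B S : Matrix (Fin d) (Fin d) ℝ} (hB : IsUnit B) (hS : S.PosDef) :
    ∃ C, proj C = S ∧ (Bᵀ * C).PosDef ∧ bw (proj B) S ^ 2 = frobSq (B - C) := by
  have hBt : IsUnit Bᵀ := (isUnit_transpose B).2 hB
  have hBd : IsUnit B.det := (isUnit_iff_isUnit_det _).1 hB
  have hBd' := (isUnit_iff_isUnit_det _).1 hBt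
  have hT : (Bᵀ * S * B).PosDef := by simpa using posDef_conj hS hBt
  have hP := posDef_matSqrt hT
  have hPt := PosDef.transpose_eq hP
  have hPP := matSqrt_mul_self hT
  -- The witness is forced: if `Bᵀ * C` is positive definite, its square is `Bᵀ * C * Cᵀ * B = Bᵀ *
  -- S * B`.
  have h1 : proj (Bᵀ⁻¹ * matSqrt (Bᵀ * S * B)) = S := by
    rw [proj, transpose_mul, hPt, ← Matrix.mul_assoc, Matrix.mul_assoc _ _ (matSqrt _), hPP,
      ← transpose_nonsing_inv, transpose_transpose]
    simp only [Matrix.mul_assoc]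
    rw [mul_nonsing_inv _ hBd, Matrix.mul_one, ← Matrix.mul_assoc, transpose_nonsing_inv,
      nonsing_inv_mul _ hBd', Matrix.one_mul]
  have h2 : (Bᵀ * (Bᵀ⁻¹ * matSqrt (Bᵀ * S * B))).PosDef := by
    rwa [mul_nonsing_inv_cancel_left _ _ hBd']
  refine ⟨_, h1, h2, ?_⟩
  rw [← bw_sq_eq_frobSq hB h2, h1]

theorem bw_sq_le_frobSq {B C : Matrix (Fin d) (Fin d) ℝ} (hB : IsUnit B) (hC : IsUnit C) :
    bw (proj B) (proj C) ^ 2 ≤ frobSq (B - C) := by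
  obtain ⟨D, hD, hP, h⟩ := exists_optimal_lift hB (posDef_proj hC)
  have hDu : IsUnit D := isUnit_of_posDef_proj (hD ▸ posDef_proj hC)
  obtain ⟨U, rfl, hU⟩ := exists_orthogonal_of_proj_eq hDu hD.symm
  rw [frobSq_sub_mul_orthogonal hP hU, h]
  linarith [frobSq_nonneg ((1 - U)ᵀ * matSqrt (Bᵀ * D))]

/-- Optimal lifts are unique. -/
theorem eq_of_optimal_lift {B C D : Matrix (Fin d) (Fin d) ℝ} (hC : IsUnit C)
    (hP : (Bᵀ * C).PosDef) (hD : proj D = proj C) (h : frobSq (B - D) ≤ frobSq (B - C)) :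
    D = C := by
  obtain ⟨U, rfl, hU⟩ := exists_orthogonal_of_proj_eq hC hD
  rw [frobSq_sub_mul_orthogonal hP hU] at h
  have h0 := frobSq_eq_zero (le_antisymm (by linarith) (frobSq_nonneg ((1 - U)ᵀ * matSqrt (Bᵀ * C))))
  have hR := (isUnit_iff_isUnit_det _).1 (posDef_matSqrt hP).isUnit
  have h1 : (1 - U)ᵀ = 0 := by
    rw [← mul_nonsing_inv_cancel_right (matSqrt (Bᵀ * C)) (1 - U)ᵀ hR, h0, Matrix.zero_mul]
  rw [transpose_eq_zero, sub_eq_zero] at h1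
  rw [← h1, Matrix.mul_one]

/-- The factor in special orthogonal position of a matrix with positive determinant. -/
theorem exists_specialOrthogonal {C S : Matrix (Fin d) (Fin d) ℝ} (hS : S.PosDef)
    (hC : proj C = S) (hdet : 0 < C.det) :
    ∃ Q ∈ specialOrthogonalGroup (Fin d) ℝ, C = matSqrt S * Q := by
  have hR := posDef_matSqrt hS
  obtain ⟨Q, rfl, hQ⟩ := exists_orthogonal_of_proj_eq hR.isUnit (hC.trans (proj_matSqrt hS).symm)
  refine ⟨Q, ?_, rfl⟩
  rw [mem_specialOrthogonalGroup_iff, mem_orthogonalGroup_iff]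
  refine ⟨hQ, ?_⟩
  rw [det_mul] at hdet
  have h1 : 0 < Q.det := (mul_pos_iff_of_pos_left hR.det_pos).1 hdet
  have h2 : Q.det * Q.det = 1 := by
    have := congrArg det hQ
    rwa [det_mul, det_transpose, det_one] at this
  nlinarith

/-! ### Positivity along a horizontal line through the spectrum of `X * A⁻¹`. -/

theorem isHermitian_mul_inv {A X : Matrix (Fin d) (Fin d) ℝ} (hA : IsUnit A)
    (hX : IsHorizontal A X) : (X * A⁻¹).IsHermitian := by
  have hd := (isUnit_iff_isUnit_det _).1 hA
  have hd' : IsUnit (Aᵀ).det := by rwa [det_transpose]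
  have h : Xᵀ * A = Aᵀ * X := sub_eq_zero.1 hX
  rw [IsHermitian, conjTranspose_eq_transpose_of_trivial, transpose_mul, transpose_nonsing_inv]
  calc Aᵀ⁻¹ * Xᵀ = Aᵀ⁻¹ * (Xᵀ * A) * A⁻¹ := by
        rw [Matrix.mul_assoc, mul_nonsing_inv_cancel_right _ _ hd]
    _ = X * A⁻¹ := by rw [h, nonsing_inv_mul_cancel_left _ _ hd']

theorem add_smul_eq_mul {A : Matrix (Fin d) (Fin d) ℝ} (X : Matrix (Fin d) (Fin d) ℝ)
    (hA : IsUnit A) (t : ℝ) : A + t • X = (1 + t • (X * A⁻¹)) * A := by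
  have hd := (isUnit_iff_isUnit_det _).1 hA
  rw [Matrix.add_mul, Matrix.one_mul, Matrix.smul_mul, nonsing_inv_mul_cancel_right _ _ hd]

theorem isUnit_add_smul_iff {A X : Matrix (Fin d) (Fin d) ℝ} (hA : IsUnit A) (t : ℝ) :
    IsUnit (A + t • X) ↔ IsUnit (1 + t • (X * A⁻¹)) := by
  have hd := (isUnit_iff_isUnit_det _).1 hA
  rw [add_smul_eq_mul X hA, isUnit_iff_isUnit_det, isUnit_iff_isUnit_det, det_mul]
  exact ⟨isUnit_of_mul_isUnit_left, fun h => h.mul hd⟩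

theorem one_add_mul_ne_zero {M : Matrix (Fin d) (Fin d) ℝ} {t μ : ℝ}
    (ht : IsUnit (1 + t • M)) (hμ : μ ∈ spectrum ℝ M) : 1 + t * μ ≠ 0 := by
  intro h
  have ht0 : t ≠ 0 := by rintro rfl; simp at h
  refine hμ (spectrum.mem_resolventSet_iff.2 ?_)
  have : algebraMap ℝ (Matrix (Fin d) (Fin d) ℝ) μ - M = (-t⁻¹) • (1 + t • M) := by
    have h1 : μ = -t⁻¹ := by field_simp; linarith
    rw [smul_add, smul_smul, h1, Algebra.algebraMap_eq_smul_one]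
    simp [ht0, sub_eq_add_neg]
  rw [this]
  exact ht.smul (Units.mk0 (-t⁻¹) (by simpa using ht0))

theorem posDef_one_add_smul_iff {M : Matrix (Fin d) (Fin d) ℝ} (hM : M.IsHermitian) (t : ℝ) :
    (1 + t • M).PosDef ↔ ∀ μ ∈ spectrum ℝ M, 0 < 1 + t * μ := by
  have hH : (1 + t • M).IsHermitian := by
    refine isHermitian_one.add ?_
    rw [IsHermitian, conjTranspose_smul, hM.eq, star_trivial]
  constructor
  · intro h μ hμ
    have h1 : 1 + t * μ ∈ spectrum ℝ (1 + t • M) := by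
      have := spectrum.subset_polynomial_aeval M (1 + Polynomial.C t * Polynomial.X)
        ⟨μ, hμ, rfl⟩
      simpa [Algebra.smul_def] using this
    rw [hH.spectrum_real_eq_range_eigenvalues] at h1
    obtain ⟨i, hi⟩ := h1
    rw [← hi]
    exact h.eigenvalues_pos i
  · intro h
    refine hH.posDef_iff_eigenvalues_pos.2 fun i => ?_
    have h1 : hH.eigenvalues i ∈ spectrum ℝ (1 + t • M) := by
      rw [hH.spectrum_real_eq_range_eigenvalues]; exact ⟨i, rfl⟩
    by_contra hneg
    refine h1 (spectrum.mem_resolventSet_iff.2 ?_)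
    set ν := hH.eigenvalues i
    -- An eigenvalue `ν` of `1 + t • M` comes from the eigenvalue `(ν - 1) / t` of `M`, which makes
    -- sense only for `t ≠ 0`.
    rcases eq_or_ne t 0 with rfl | ht
    · have : algebraMap ℝ (Matrix (Fin d) (Fin d) ℝ) ν - (1 + (0 : ℝ) • M) =
          algebraMap ℝ _ (ν - 1) := by simp
      rw [this]
      exact (IsUnit.mk0 (ν - 1) (by linarith)).map _
    · have h2 : (ν - 1) / t ∉ spectrum ℝ M := fun hmem => by
        have := h _ hmem
        rw [mul_div_cancel₀ _ ht] at this
        linarith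
      have h3 := (spectrum.notMem_iff.1 h2).smul (Units.mk0 t ht)
      convert h3 using 1
      rw [Units.smul_mk0, smul_sub, Algebra.algebraMap_eq_smul_one,
        Algebra.algebraMap_eq_smul_one, smul_smul, mul_div_cancel₀ _ ht, sub_smul, one_smul]
      abel

open scoped MatrixOrder in
theorem posDef_mul_of_commute {P R : Matrix (Fin d) (Fin d) ℝ} (hP : P.PosDef) (hR : R.PosDef)
    (h : Commute P R) : (P * R).PosDef :=
  ((hP.isStrictlyPositive.commute_iff hR.isStrictlyPositive).1 h).posDef

theorem bw_nonneg (S T : Matrix (Fin d) (Fin d) ℝ) : 0 ≤ bw S T := Real.sqrt_nonneg _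

/-! ### Horizontal lines as admissible geodesics. -/

/-- Horizontal lines are projected to geodesics. -/
theorem bw_proj_line {A X : Matrix (Fin d) (Fin d) ℝ} (hA : IsUnit A)
    (hX1 : frobSq X = 1) {s t : ℝ} (hs : (1 + s • (X * A⁻¹)).PosDef)
    (ht : (1 + t • (X * A⁻¹)).PosDef) : bw (proj (A + s • X)) (proj (A + t • X)) = |s - t| := by
  have hst := PosDef.transpose_eq hs
  have hP : ((A + s • X)ᵀ * (A + t • X)).PosDef := by
    -- The product of the two points is `Aᵀ * (1 + s • M) * (1 + t • M) * A`, a congruence of a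
    -- product of commuting positive definite matrices, so the two points are optimal lifts of each
    -- other.
    have hc : Commute (1 + s • (X * A⁻¹)) (1 + t • (X * A⁻¹)) :=
      (Commute.one_left _).add_left
        ((Commute.one_right _).add_right (((Commute.refl _).smul_right _).smul_left _))
    have := posDef_conj (posDef_mul_of_commute hs ht hc) ((isUnit_transpose A).2 hA)
    rw [add_smul_eq_mul X hA, add_smul_eq_mul X hA, transpose_mul, hst]
    simpa only [Matrix.mul_assoc, transpose_transpose] using this
  have h := bw_sq_eq_frobSq ((isUnit_add_smul_iff hA s).2 hs.isUnit) hP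
  have e : A + s • X - (A + t • X) = (s - t) • X := by rw [sub_smul]; abel
  rw [e, frobSq_smul, hX1, mul_one] at h
  rw [← abs_of_nonneg (bw_nonneg _ _)]
  exact (sq_eq_sq_iff_abs_eq_abs _ _).1 h

theorem isBWGeodesicOn_line {A X : Matrix (Fin d) (Fin d) ℝ} (hA : IsUnit A)
    (hX1 : frobSq X = 1) {I : Set ℝ} (hne : I.Nonempty)
    (hoc : I.OrdConnected) (hI : ∀ t ∈ I, (1 + t • (X * A⁻¹)).PosDef) :
    IsBWGeodesicOn (fun t => proj (A + t • X)) I :=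
  ⟨hne, hoc, fun t ht => posDef_proj ((isUnit_add_smul_iff hA t).2 (hI t ht).isUnit),
    fun _ hs _ ht => bw_proj_line hA hX1 (hI _ hs) (hI _ ht)⟩

/-- Membership gives `0 ≤ 1 + t * μ`; invertibility excludes equality. -/
theorem posDef_of_mem_clipInterval {A X : Matrix (Fin d) (Fin d) ℝ} (hA : IsUnit A)
    (hX : IsHorizontal A X) {ε t : ℝ} (hε : 0 ≤ ε) (ht : t ∈ clipInterval ε A X)
    (hu : IsUnit (A + t • X)) : (1 + t • (X * A⁻¹)).PosDef := by
  rw [posDef_one_add_smul_iff (isHermitian_mul_inv hA hX)]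
  intro μ hμ
  have hne := one_add_mul_ne_zero ((isUnit_add_smul_iff hA t).1 hu) hμ
  refine lt_of_le_of_ne ?_ hne.symm
  rcases lt_trichotomy μ 0 with h | rfl | h
  · have := (ht μ hμ).2 h
    have h1 : -1 / μ * μ = -1 := div_mul_cancel₀ _ h.ne
    nlinarith
  · simp
  · have := (ht μ hμ).1 h
    have h1 : -1 / μ * μ = -1 := div_mul_cancel₀ _ h.ne'
    nlinarith

/-- The open margin replaces invertibility: moving by less than `ε` cannot reach the root `-1 / μ`.
This makes the extended geodesic regular. -/
theorem posDef_of_near_clipInterval {A X : Matrix (Fin d) (Fin d) ℝ} (hA : IsUnit A)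
    (hX : IsHorizontal A X) {ε s t : ℝ} (hs : s ∈ clipInterval ε A X) (hst : |t - s| < ε) :
    (1 + t • (X * A⁻¹)).PosDef := by
  rw [posDef_one_add_smul_iff (isHermitian_mul_inv hA hX)]
  intro μ hμ
  obtain ⟨ha, hb⟩ := abs_lt.1 hst
  rcases lt_trichotomy μ 0 with h | rfl | h
  · have := (hs μ hμ).2 h
    have h1 : -1 / μ * μ = -1 := div_mul_cancel₀ _ h.ne
    nlinarith
  · simp
  · have := (hs μ hμ).1 h
    have h1 : -1 / μ * μ = -1 := div_mul_cancel₀ _ h.ne'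
    nlinarith

theorem isClosed_clipInterval (ε : ℝ) (A X : Matrix (Fin d) (Fin d) ℝ) :
    IsClosed (clipInterval ε A X) := by
  have : clipInterval ε A X = ⋂ μ ∈ spectrum ℝ (X * A⁻¹),
      {t | (0 < μ → -1 / μ + ε ≤ t)} ∩ {t | (μ < 0 → t ≤ -1 / μ - ε)} := by
    ext t; simp [clipInterval]
  rw [this]
  refine isClosed_biInter fun μ _ => IsClosed.inter ?_ ?_
  · by_cases h : 0 < μ
    · simpa [h] using! isClosed_Ici
    · simp [h]
  · by_cases h : μ < 0
    · simpa [h] using! isClosed_Iic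
    · simp [h]

theorem ordConnected_clipInterval (ε : ℝ) (A X : Matrix (Fin d) (Fin d) ℝ) :
    (clipInterval ε A X).OrdConnected :=
  ⟨fun _ hs _ ht _ hr μ hμ =>
    ⟨fun h => ((hs μ hμ).1 h).trans hr.1, fun h => hr.2.trans ((ht μ hμ).2 h)⟩⟩

/-- Each `1 + t * μ` is affine in `t`, so positivity at two times persists between them. -/
theorem ordConnected_regular {A X : Matrix (Fin d) (Fin d) ℝ} (hA : IsUnit A)
    (hX : IsHorizontal A X) {ε : ℝ} (hε : 0 ≤ ε) :
    {t | t ∈ clipInterval ε A X ∧ IsUnit (A + t • X)}.OrdConnected := by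
  refine ⟨fun s hs t ht r hr => ⟨(ordConnected_clipInterval ε A X).out hs.1 ht.1 hr, ?_⟩⟩
  have hM := isHermitian_mul_inv hA hX
  have h1 := (posDef_one_add_smul_iff hM _).1 (posDef_of_mem_clipInterval hA hX hε hs.1 hs.2)
  have h2 := (posDef_one_add_smul_iff hM _).1 (posDef_of_mem_clipInterval hA hX hε ht.1 ht.2)
  refine (isUnit_add_smul_iff hA r).2 (PosDef.isUnit ?_)
  rw [posDef_one_add_smul_iff hM]
  intro μ hμ
  have h3 := h1 μ hμ
  have h4 := h2 μ hμ
  rcases le_total 0 μ with h | h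
  · nlinarith [hr.1]
  · nlinarith [hr.2]

theorem isAdmissible_line {A X : Matrix (Fin d) (Fin d) ℝ} (hA : IsUnit A)
    (hX : IsHorizontal A X) (hX1 : frobSq X = 1) {ε : ℝ} (hε : 0 ≤ ε) {I : Set ℝ}
    (hne : I.Nonempty) (hoc : I.OrdConnected)
    (hI : ∀ t ∈ I, t ∈ clipInterval ε A X ∧ IsUnit (A + t • X)) :
    IsAdmissible ε (fun t => proj (A + t • X)) I := by
  have hI' : ∀ t ∈ I, (1 + t • (X * A⁻¹)).PosDef := fun t ht =>
    posDef_of_mem_clipInterval hA hX hε (hI t ht).1 (hI t ht).2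
  refine ⟨isBWGeodesicOn_line hA hX1 hne hoc hI', _, Set.eqOn_refl _ _,
    isBWGeodesicOn_line hA hX1 (hne.mono Set.subset_union_left) ?_ ?_⟩
  -- The thickening is empty for `ε = 0`, whereas for `ε > 0` it contains `I` and inherits
  -- convexity.
  · rcases hε.eq_or_lt with rfl | h
    · rwa [Metric.thickening_of_nonpos le_rfl I, Set.union_empty]
    · rw [Set.union_eq_self_of_subset_left (Metric.self_subset_thickening h I)]
      exact (hoc.convex.thickening ε).ordConnected
  · rintro t (ht | ht)
    · exact hI' t ht
    · obtain ⟨s, hs, hst⟩ := Metric.mem_thickening_iff.1 ht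
      exact posDef_of_near_clipInterval hA hX (hI s hs).1 (by rwa [← Real.dist_eq])

/-! ### Clipping as nearest-point projection. -/

theorem clip_spec {J : Set ℝ} (hne : J.Nonempty) (hcl : IsClosed J) (hoc : J.OrdConnected)
    (t : ℝ) : clip J t ∈ J ∧ ∀ r ∈ J, |clip J t - t| ≤ |r - t| := by
  unfold clip
  split_ifs with h1 h2
  · exact ⟨h1, fun r _ => by simp⟩
  · have hb : BddBelow J := ⟨t, fun r hr => (h2 r hr).le⟩
    have hm := hcl.csInf_mem hne hb
    refine ⟨hm, fun r hr => ?_⟩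
    have h3 := h2 _ hm
    have h4 := csInf_le hb hr
    rw [abs_of_nonneg (by linarith), abs_of_nonneg (by linarith)]
    linarith
  · push Not at h2
    obtain ⟨q, hq, hqt⟩ := h2
    have h3 : ∀ r ∈ J, r ≤ t := fun r hr => by
      by_contra! hrt
      exact h1 (hoc.out hq hr ⟨hqt, hrt.le⟩)
    have hb : BddAbove J := ⟨t, h3⟩
    have hm := hcl.csSup_mem hne hb
    refine ⟨hm, fun r hr => ?_⟩
    have h4 := h3 _ hm
    have h5 := le_csSup hb hr
    rw [abs_of_nonpos (by linarith), abs_of_nonpos (by linarith)]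
    linarith

/-- The clipped time minimizes the squared distance over the clipping interval. -/
theorem frobSq_clippedTime_le {A X : Matrix (Fin d) (Fin d) ℝ} (hX1 : frobSq X = 1) {ε r : ℝ}
    (S Q : Matrix (Fin d) (Fin d) ℝ) (hr : r ∈ clipInterval ε A X) :
    frobSq (A + clippedTime ε S A X Q • X - matSqrt S * Q) ≤
      frobSq (A + r • X - matSqrt S * Q) := by
  have h := (clip_spec ⟨r, hr⟩ (isClosed_clipInterval ε A X) (ordConnected_clipInterval ε A X)
    (frobInner (matSqrt S * Q - A) X)).2 r hr
  rw [frobSq_line_sub _ _ _ hX1, frobSq_line_sub _ _ _ hX1]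
  exact add_le_add_left (sq_le_sq.2 h) _

theorem clippedTime_mem {ε : ℝ} {A X : Matrix (Fin d) (Fin d) ℝ}
    (hne : (clipInterval ε A X).Nonempty) (S Q : Matrix (Fin d) (Fin d) ℝ) :
    clippedTime ε S A X Q ∈ clipInterval ε A X :=
  (clip_spec hne (isClosed_clipInterval ε A X) (ordConnected_clipInterval ε A X) _).1

/-! ### Lifting geodesics to horizontal lines. -/

/-- A geodesic through three times lies on the line through the optimal lifts of two of them. -/
theorem exists_lift_of_isBWGeodesicOn {γ : ℝ → Matrix (Fin d) (Fin d) ℝ} {K : Set ℝ}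
    (h : IsBWGeodesicOn γ K) {s₀ s₁ t : ℝ} (hs₀ : s₀ ∈ K) (hs₁ : s₁ ∈ K) (ht : t ∈ K)
    (hlt : s₀ < s₁) {B C : Matrix (Fin d) (Fin d) ℝ} (hB : proj B = γ s₀) (hC : proj C = γ s₁)
    (hP : (Bᵀ * C).PosDef) (hBC : frobSq (B - C) = (s₁ - s₀) ^ 2) :
    γ t = proj (B + (t - s₀) • (s₁ - s₀)⁻¹ • (C - B)) := by
  obtain ⟨-, -, hpd, hd⟩ := h
  have hne : s₁ - s₀ ≠ 0 := by linarith
  have hBu : IsUnit B := isUnit_of_posDef_proj (hB ▸ hpd _ hs₀)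
  have hCu : IsUnit C := isUnit_of_posDef_proj (hC ▸ hpd _ hs₁)
  have hCB : frobSq (C - B) = (s₁ - s₀) ^ 2 := by rw [frobSq_sub_comm, hBC]
  have of_eq : ∀ D, proj D = γ t → (s₁ - s₀) • (D - B) = (t - s₀) • (C - B) →
      γ t = proj (B + (t - s₀) • (s₁ - s₀)⁻¹ • (C - B)) := by
    intro D hD he
    rw [smul_comm, ← he, smul_smul, inv_mul_cancel₀ hne, one_smul, add_sub_cancel, hD]
  rcases lt_trichotomy t s₀ with h1 | rfl | h1
  -- Here `γ s₀` is the middle point. The distance from `γ t` to `γ s₁` bounds `‖D - C‖` from below,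
  -- so the triangle inequality through `B` is tight.
  · obtain ⟨D, hD, -, hDd⟩ := exists_optimal_lift hBu (hpd t ht)
    have hDu : IsUnit D := isUnit_of_posDef_proj (hD ▸ hpd _ ht)
    rw [hB, hd _ hs₀ _ ht, sq_abs] at hDd
    have h3 := bw_sq_le_frobSq hDu hCu
    rw [hD, hC, hd _ ht _ hs₁, sq_abs, frobSq_sub_comm] at h3
    have h4 := smul_eq_smul_of_triangle (u := B - D) (v := C - B) (a := s₀ - t) (b := s₁ - s₀)
      (by linarith) (by linarith) hDd.symm hCB
      (by rw [add_comm (B - D), sub_add_sub_cancel]; linarith)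
    refine of_eq D hD ?_
    rw [← neg_sub B D, smul_neg, h4, ← neg_smul, neg_sub]
  · simp [hB]
  rcases lt_or_ge t s₁ with h2 | h2
  -- Lifting successively from `B` to `D` and from `D` to `E` gives collinear points, but `E` could
  -- differ from `C`. Collinearity yields `‖E - B‖ = s₁ - s₀`, and uniqueness of optimal lifts then
  -- gives `E = C`.
  · obtain ⟨D, hD, -, hDd⟩ := exists_optimal_lift hBu (hpd t ht)
    have hDu : IsUnit D := isUnit_of_posDef_proj (hD ▸ hpd _ ht)
    obtain ⟨E, hE, -, hEd⟩ := exists_optimal_lift hDu (hpd s₁ hs₁)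
    have hEu : IsUnit E := isUnit_of_posDef_proj (hE ▸ hpd _ hs₁)
    rw [hB, hd _ hs₀ _ ht, sq_abs, frobSq_sub_comm] at hDd
    rw [hD, hd _ ht _ hs₁, sq_abs, frobSq_sub_comm] at hEd
    have h3 := bw_sq_le_frobSq hBu hEu
    rw [hB, hE, hd _ hs₀ _ hs₁, sq_abs, frobSq_sub_comm] at h3
    have h4 := smul_eq_smul_of_triangle (u := D - B) (v := E - D) (a := t - s₀) (b := s₁ - t)
      (by linarith) (by linarith) (by rw [← hDd]; ring) (by rw [← hEd]; ring)
      (by rw [add_comm (_ - B), sub_add_sub_cancel]; linarith)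
    have h5 : (s₁ - s₀) • (D - B) = (t - s₀) • (E - B) := by
      calc (s₁ - s₀) • (D - B) = (s₁ - t) • (D - B) + (t - s₀) • (D - B) := by
            rw [← add_smul]; congr 1; ring
        _ = _ := by rw [h4, ← smul_add]; congr 1; abel
    have h6 : frobSq (E - B) = (s₁ - s₀) ^ 2 := by
      have := congrArg frobSq h5
      rw [frobSq_smul, frobSq_smul, ← hDd] at this
      have h0 : (t - s₀) ^ 2 ≠ 0 := pow_ne_zero _ (by linarith)
      exact mul_left_cancel₀ h0 (by rw [← this]; ring)
    have h7 := eq_of_optimal_lift hCu hP (hE.trans hC.symm) (by rw [frobSq_sub_comm, h6, hBC])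
    exact of_eq D hD (h7 ▸ h5)
  · obtain ⟨D, hD, -, hDd⟩ := exists_optimal_lift hCu (hpd t ht)
    have hDu : IsUnit D := isUnit_of_posDef_proj (hD ▸ hpd _ ht)
    rw [hC, hd _ hs₁ _ ht, sq_abs, frobSq_sub_comm] at hDd
    have h3 := bw_sq_le_frobSq hBu hDu
    rw [hB, hD, hd _ hs₀ _ ht, sq_abs, frobSq_sub_comm] at h3
    have h4 := smul_eq_smul_of_triangle (u := C - B) (v := D - C) (a := s₁ - s₀) (b := t - s₁)
      (by linarith) (by linarith) hCB (by rw [← hDd]; ring)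
      (by rw [add_comm (_ - B), sub_add_sub_cancel]; linarith)
    refine of_eq D hD ?_
    calc (s₁ - s₀) • (D - B) = (s₁ - s₀) • (D - C) + (s₁ - s₀) • (C - B) := by
          rw [← smul_add]; congr 1; abel
      _ = (t - s₀) • (C - B) := by rw [← h4, ← add_smul]; congr 1; ring

/-- Geodesics lift to horizontal lines. -/
theorem exists_line_of_isBWGeodesicOn (hd0 : d ≠ 0) {γ : ℝ → Matrix (Fin d) (Fin d) ℝ}
    {K : Set ℝ} (h : IsBWGeodesicOn γ K) :
    ∃ s₀ ∈ K, ∃ B X : Matrix (Fin d) (Fin d) ℝ, 0 < B.det ∧ IsHorizontal B X ∧ frobSq X = 1 ∧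
      ∀ t ∈ K, γ t = proj (B + (t - s₀) • X) := by
  obtain ⟨s, hs⟩ := h.1
  -- A single point determines no direction; the normalized lift itself serves as a horizontal
  -- vector, being nonzero because `d ≠ 0`.
  by_cases hsub : K.Subsingleton
  · have hB := posDef_matSqrt (h.2.2.1 s hs)
    have hpos : 0 < frobSq (matSqrt (γ s)) := by
      refine lt_of_le_of_ne (frobSq_nonneg _) fun h0 => ?_
      have hdet := hB.det_pos
      have : NeZero d := ⟨hd0⟩
      rw [frobSq_eq_zero h0.symm, det_zero] at hdet
      exact lt_irrefl _ hdet
    refine ⟨s, hs, matSqrt (γ s), (√(frobSq (matSqrt (γ s))))⁻¹ • matSqrt (γ s), hB.det_pos, ?_,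
      ?_, ?_⟩
    · simp [IsHorizontal]
    · rw [frobSq_smul, inv_pow, Real.sq_sqrt hpos.le, inv_mul_cancel₀ hpos.ne']
    · intro t ht
      rw [hsub ht hs, sub_self, zero_smul, add_zero, proj_matSqrt (h.2.2.1 s hs)]
  · rw [Set.not_subsingleton_iff] at hsub
    obtain ⟨s₀, hs₀, s₁, hs₁, hlt⟩ := hsub.exists_lt
    have hB := posDef_matSqrt (h.2.2.1 s₀ hs₀)
    have hBp := proj_matSqrt (h.2.2.1 s₀ hs₀)
    obtain ⟨C, hC, hP, hBC⟩ := exists_optimal_lift hB.isUnit (h.2.2.1 s₁ hs₁)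
    rw [hBp, h.2.2.2 _ hs₀ _ hs₁, sq_abs] at hBC
    have hBC' : frobSq (matSqrt (γ s₀) - C) = (s₁ - s₀) ^ 2 := by rw [← hBC]; ring
    refine ⟨s₀, hs₀, matSqrt (γ s₀), (s₁ - s₀)⁻¹ • (C - matSqrt (γ s₀)), hB.det_pos, ?_, ?_,
      fun t ht => exists_lift_of_isBWGeodesicOn h hs₀ hs₁ ht hlt hBp hC hP hBC'⟩
    · have := PosDef.transpose_eq hP
      rw [transpose_mul, transpose_transpose] at this
      rw [IsHorizontal, transpose_smul, transpose_sub, Matrix.smul_mul, Matrix.mul_smul,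
        ← smul_sub, Matrix.sub_mul, Matrix.mul_sub, this]
      simp
    · have : s₁ - s₀ ≠ 0 := by linarith
      rw [frobSq_smul, frobSq_sub_comm, hBC', inv_pow, inv_mul_cancel₀ (pow_ne_zero _ this)]

/-! ### From admissible geodesics to feasible lifted points. -/

/-- On an interval of invertibility containing `0`, the factor `1 + t X A⁻¹` is positive
definite. -/
theorem posDef_of_ordConnected {A X : Matrix (Fin d) (Fin d) ℝ} (hA : IsUnit A)
    (hX : IsHorizontal A X) {K : Set ℝ} (hoc : K.OrdConnected) (h0 : 0 ∈ K)
    (hK : ∀ t ∈ K, IsUnit (A + t • X)) {t : ℝ} (ht : t ∈ K) :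
    (1 + t • (X * A⁻¹)).PosDef := by
  rw [posDef_one_add_smul_iff (isHermitian_mul_inv hA hX)]
  intro μ hμ
  by_contra! hneg
  have hμ0 : μ ≠ 0 := by rintro rfl; simp at hneg; linarith
  -- If `1 + t * μ ≤ 0`, its root `-1 / μ` lies between `0` and `t`, where invertibility is assumed.
  have hmem : -1 / μ ∈ K := by
    have h1 : -1 / μ * μ = -1 := div_mul_cancel₀ _ hμ0
    rcases lt_or_gt_of_ne hμ0 with h | h
    · exact hoc.out h0 ht ⟨by nlinarith, by nlinarith⟩
    · exact hoc.out ht h0 ⟨by nlinarith, by nlinarith⟩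
  refine one_add_mul_ne_zero ((isUnit_add_smul_iff hA _).1 (hK _ hmem)) hμ ?_
  rw [div_mul_cancel₀ _ hμ0]
  norm_num

/-- Times that keep distance `ε` from the degenerate ones lie in the clipping interval. -/
theorem mem_clipInterval_of_forall {A X : Matrix (Fin d) (Fin d) ℝ} (hA : IsUnit A)
    (hX : IsHorizontal A X) {ε t : ℝ}
    (h : ∀ s, s = t ∨ |s - t| < ε → (1 + s • (X * A⁻¹)).PosDef) : t ∈ clipInterval ε A X := by
  intro μ hμ
  have key : ∀ s, s = t ∨ |s - t| < ε → 0 < 1 + s * μ := fun s hs =>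
    (posDef_one_add_smul_iff (isHermitian_mul_inv hA hX) s).1 (h s hs) μ hμ
  constructor
  · intro hpos
    by_contra! hlt
    have h1 : -1 / μ * μ = -1 := div_mul_cancel₀ _ hpos.ne'
    have h2 := key t (Or.inl rfl)
    have h3 : -1 / μ < t := by
      by_contra! h4
      nlinarith
    have h5 := key (-1 / μ) (Or.inr (by rw [abs_lt]; constructor <;> linarith))
    linarith
  · intro hneg
    by_contra! hlt
    have h1 : -1 / μ * μ = -1 := div_mul_cancel₀ _ hneg.ne
    have h2 := key t (Or.inl rfl)
    have h3 : t < -1 / μ := by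
      by_contra! h4
      nlinarith
    have h5 := key (-1 / μ) (Or.inr (by rw [abs_lt]; constructor <;> linarith))
    linarith

/-- Every admissible geodesic, with a choice of times on it, is matched by a feasible point of the
lifted problem of no larger cost. -/
theorem exists_isLiftedFeasible (hd0 : d ≠ 0) {ε : ℝ}
    {S : Fin n → Matrix (Fin d) (Fin d) ℝ} (hS : ∀ i, (S i).PosDef)
    {γ : ℝ → Matrix (Fin d) (Fin d) ℝ} {I : Set ℝ} (h : IsAdmissible ε γ I) {τ : Fin n → ℝ}
    (hτ : ∀ i, τ i ∈ I) :
    ∃ (A X : Matrix (Fin d) (Fin d) ℝ) (Q : Fin n → Matrix (Fin d) (Fin d) ℝ),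
      IsLiftedFeasible ε A X Q ∧ liftedCost ε S A X Q ≤ ∑ i, bw (γ (τ i)) (S i) ^ 2 := by
  obtain ⟨⟨⟨r, hr⟩, -, -, -⟩, γ', heq, hγ'⟩ := h
  -- The extension `γ'` is lifted rather than `γ`, so that the line remains regular on the whole
  -- margin. The base time `s` may lie outside `I`.
  obtain ⟨s, hs, B, X, hdet, hX, hX1, hline⟩ := exists_line_of_isBWGeodesicOn hd0 hγ'
  have hB : IsUnit B := (isUnit_iff_isUnit_det _).2 hdet.ne'.isUnit
  have hpos : ∀ t ∈ I ∪ Metric.thickening ε I, (1 + (t - s) • (X * B⁻¹)).PosDef := by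
    intro t ht
    refine posDef_of_ordConnected hB hX (K := {u | u + s ∈ I ∪ Metric.thickening ε I})
      ⟨fun a ha b hb c hc => hγ'.2.1.out ha hb ⟨by linarith [hc.1], by linarith [hc.2]⟩⟩
      (by simpa using hs) (fun u hu => ?_) (by simpa using ht)
    have h1 := hline _ hu
    rw [add_sub_cancel_right] at h1
    exact isUnit_of_posDef_proj (h1 ▸ hγ'.2.2.1 _ hu)
  have hclip : ∀ t ∈ I, t - s ∈ clipInterval ε B X := by
    intro t ht
    refine mem_clipInterval_of_forall hB hX fun u hu => ?_
    have hmem : u + s ∈ I ∪ Metric.thickening ε I := by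
      rcases hu with rfl | hu
      · exact Or.inl (by simpa using ht)
      · refine Or.inr (Metric.mem_thickening_iff.2 ⟨t, ht, ?_⟩)
        rw [Real.dist_eq]
        convert hu using 2
        ring
    simpa using hpos _ hmem
  have hQ : ∀ i, ∃ Q ∈ specialOrthogonalGroup (Fin d) ℝ,
      bw (γ (τ i)) (S i) ^ 2 = frobSq (B + (τ i - s) • X - matSqrt (S i) * Q) := by
    intro i
    have hp := hpos _ (Or.inl (hτ i))
    have hu := (isUnit_add_smul_iff hB _).2 hp.isUnit
    obtain ⟨C, hC, hP, hbw⟩ := exists_optimal_lift hu (hS i)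
    -- The determinant stays positive along the line, and positivity of the optimal product
    -- transfers this sign to `C`. This is why special orthogonal factors suffice.
    have hdet2 : 0 < C.det := by
      have h1 := hP.det_pos
      rw [det_mul, det_transpose, add_smul_eq_mul X hB, det_mul] at h1
      exact (mul_pos_iff_of_pos_left (mul_pos hp.det_pos hdet)).1 h1
    obtain ⟨Q, hQ, rfl⟩ := exists_specialOrthogonal (hS i) hC hdet2
    exact ⟨Q, hQ, by rw [heq (hτ i), hline _ (Or.inl (hτ i)), hbw]⟩
  choose Q hQ1 hQ2 using hQ
  refine ⟨B, X, Q, ⟨hB, hX, hX1, hQ1, ⟨_, hclip r hr⟩⟩, Finset.sum_le_sum fun i _ => ?_⟩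
  rw [hQ2]
  exact frobSq_clippedTime_le hX1 _ _ (hclip _ (hτ i))

/-- The infima are taken independently, so near-optimal times can be chosen for each index. Dividing
the gap by `n + 1` leaves total slack below the gap, also for `n = 0`. -/
theorem le_sum_ciInf {ι : Type*} [Nonempty ι] (f : Fin n → ι → ℝ) {c : ℝ}
    (h : ∀ τ : Fin n → ι, c ≤ ∑ i, f i (τ i)) : c ≤ ∑ i, ⨅ t, f i t := by
  by_contra! hlt
  set s := ∑ i, ⨅ t, f i t
  have hδ : 0 < (c - s) / (n + 1) := div_pos (by linarith) (by positivity)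
  have hex : ∀ i, ∃ t, f i t < (⨅ t, f i t) + (c - s) / (n + 1) := fun i =>
    exists_lt_of_ciInf_lt (by linarith)
  choose τ hτ using hex
  have h1 : ∑ i, f i (τ i) ≤ ∑ i : Fin n, ((⨅ t, f i t) + (c - s) / (n + 1)) :=
    Finset.sum_le_sum fun i _ => (hτ i).le
  rw [Finset.sum_add_distrib, Finset.sum_const, Finset.card_univ, Fintype.card_fin,
    nsmul_eq_mul] at h1
  have h2 := h τ
  have h3 : (n + 1 : ℝ) * ((c - s) / (n + 1)) = c - s := mul_div_cancel₀ _ (by positivity)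
  change _ ≤ s + _ at h1
  nlinarith

theorem IsLiftedSolution.le_gpcaCost {ε : ℝ}
    {S : Fin n → Matrix (Fin d) (Fin d) ℝ} (hS : ∀ i, (S i).PosDef)
    {A X : Matrix (Fin d) (Fin d) ℝ} {Q : Fin n → Matrix (Fin d) (Fin d) ℝ}
    (hsol : IsLiftedSolution ε S A X Q) {γ : ℝ → Matrix (Fin d) (Fin d) ℝ} {I : Set ℝ}
    (h : IsAdmissible ε γ I) : liftedCost ε S A X Q ≤ gpcaCost S γ I := by
  have hd0 : d ≠ 0 := by
    rintro rfl
    have := hsol.1.2.2.1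
    simp [frobSq, frobInner] at this
  have : Nonempty I := h.1.1.to_subtype
  refine le_sum_ciInf (fun i (t : I) => bw (γ t) (S i) ^ 2) fun τ => ?_
  obtain ⟨A', X', Q', hf, hc⟩ :=
    exists_isLiftedFeasible hd0 hS h (τ := fun i => (τ i : ℝ)) fun i => (τ i).2
  exact (hsol.2 A' X' Q' hf).trans hc

/-! ### Cost of the optimal line and boundary times. -/

theorem ciInf_bw_sq_le {γ : ℝ → Matrix (Fin d) (Fin d) ℝ} {I : Set ℝ}
    (S : Matrix (Fin d) (Fin d) ℝ) {t : ℝ} (ht : t ∈ I) :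
    ⨅ t : I, bw (γ t) S ^ 2 ≤ bw (γ t) S ^ 2 :=
  ciInf_le (f := fun t : I => bw (γ t) S ^ 2) ⟨0, by rintro _ ⟨r, rfl⟩; positivity⟩ ⟨t, ht⟩

theorem bw_sq_line_le {A X S Q : Matrix (Fin d) (Fin d) ℝ} (hS : S.PosDef)
    (hQ : Q ∈ specialOrthogonalGroup (Fin d) ℝ) {t : ℝ} (ht : IsUnit (A + t • X)) :
    bw (proj (A + t • X)) S ^ 2 ≤ frobSq (A + t • X - matSqrt S * Q) := by
  have hQ' : Q * Qᵀ = 1 := by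
    have := (mem_specialOrthogonalGroup_iff.1 hQ).1
    rwa [mem_orthogonalGroup_iff] at this
  have hp : proj (matSqrt S * Q) = S := by
    rw [proj, transpose_mul, Matrix.mul_assoc, ← Matrix.mul_assoc Q, hQ', Matrix.one_mul]
    exact proj_matSqrt hS
  have hu : IsUnit (matSqrt S * Q) := isUnit_of_posDef_proj (hp.symm ▸ hS)
  simpa only [hp] using bw_sq_le_frobSq ht hu

/-- The boundary times of the clipping interval without margin are limits of regular times. -/
theorem mem_closure_regular_zero {A X : Matrix (Fin d) (Fin d) ℝ} (hA : IsUnit A)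
    (hX : IsHorizontal A X) {t : ℝ} (ht : t ∈ clipInterval 0 A X) :
    t ∈ closure {t | t ∈ clipInterval 0 A X ∧ IsUnit (A + t • X)} := by
  have hM := isHermitian_mul_inv hA hX
  have h0 : (0 : ℝ) ∈ clipInterval 0 A X := by
    refine fun μ _ => ⟨fun h => ?_, fun h => ?_⟩
    · simpa using! (div_neg_of_neg_of_pos (by norm_num : (-1 : ℝ) < 0) h).le
    · simpa using! (div_pos_of_neg_of_neg (by norm_num : (-1 : ℝ) < 0) h).le
  -- Times are shrunk towards `0`: for `0 < θ < 1`, `1 + θ * t * μ = (1 - θ) + θ * (1 + t * μ)` is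
  -- strictly positive.
  have htend : Filter.Tendsto (fun θ : ℝ => θ * t) (nhdsWithin 1 (Set.Ioo 0 1)) (nhds t) := by
    have : Filter.Tendsto (fun θ : ℝ => θ * t) (nhds 1) (nhds (1 * t)) :=
      (continuous_mul_const t).tendsto 1
    rw [one_mul] at this
    exact this.mono_left nhdsWithin_le_nhds
  have hne : (nhdsWithin (1 : ℝ) (Set.Ioo 0 1)).NeBot := by
    rw [← mem_closure_iff_nhdsWithin_neBot, closure_Ioo (by norm_num)]
    simp
  refine mem_closure_of_tendsto htend ?_
  filter_upwards [self_mem_nhdsWithin] with θ hθ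
  have hmem : θ * t ∈ clipInterval 0 A X := by
    have hc := (ordConnected_clipInterval 0 A X).convex h0 ht
      (sub_nonneg.2 hθ.2.le) hθ.1.le (by ring)
    simpa using hc
  refine ⟨hmem, (isUnit_add_smul_iff hA _).2 (PosDef.isUnit ?_)⟩
  rw [posDef_one_add_smul_iff hM]
  intro μ hμ
  have h1 : 0 ≤ 1 + t * μ := by
    rcases lt_trichotomy μ 0 with h | rfl | h
    · have := (ht μ hμ).2 h
      have h2 : -1 / μ * μ = -1 := div_mul_cancel₀ _ h.ne
      nlinarith
    · simp
    · have := (ht μ hμ).1 h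
      have h2 : -1 / μ * μ = -1 := div_mul_cancel₀ _ h.ne'
      nlinarith
  nlinarith [hθ.1, hθ.2, mul_nonneg hθ.1.le h1]

theorem isUnit_of_mem_clipInterval {A X : Matrix (Fin d) (Fin d) ℝ} (hA : IsUnit A)
    (hX : IsHorizontal A X) {ε t : ℝ} (hε : 0 < ε) (ht : t ∈ clipInterval ε A X) :
    IsUnit (A + t • X) :=
  (isUnit_add_smul_iff hA t).2 (posDef_of_near_clipInterval hA hX ht (by simpa)).isUnit

theorem mem_closure_regular {ε : ℝ} (hε : 0 ≤ ε) {A X : Matrix (Fin d) (Fin d) ℝ}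
    (hA : IsUnit A) (hX : IsHorizontal A X) {t : ℝ} (ht : t ∈ clipInterval ε A X) :
    t ∈ closure {t | t ∈ clipInterval ε A X ∧ IsUnit (A + t • X)} := by
  rcases hε.eq_or_lt with rfl | h
  · exact mem_closure_regular_zero hA hX ht
  · exact subset_closure ⟨ht, isUnit_of_mem_clipInterval hA hX h ht⟩

/-- Without a margin the clipped point may be singular. The right-hand side is a continuous
quadratic in `t`, so the bound passes from regular times to their limits. -/
theorem ciInf_bw_sq_line_le_of_mem_closure {A X S Q : Matrix (Fin d) (Fin d) ℝ}
    (hX1 : frobSq X = 1) (hS : S.PosDef) (hQ : Q ∈ specialOrthogonalGroup (Fin d) ℝ) {I : Set ℝ}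
    (hI : ∀ t ∈ I, IsUnit (A + t • X)) {t : ℝ} (ht : t ∈ closure I) :
    ⨅ r : I, bw (proj (A + (r : ℝ) • X)) S ^ 2 ≤ frobSq (A + t • X - matSqrt S * Q) := by
  have hcont : Continuous fun t : ℝ => frobSq (A + t • X - matSqrt S * Q) := by
    simp_rw [frobSq_line_sub _ _ _ hX1]
    fun_prop
  refine closure_minimal (t := {t | ⨅ r : I, bw (proj (A + (r : ℝ) • X)) S ^ 2 ≤
    frobSq (A + t • X - matSqrt S * Q)}) (fun r hr => ?_)
    (isClosed_le continuous_const hcont) ht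
  exact (ciInf_bw_sq_le (γ := fun t => proj (A + t • X)) S hr).trans
    (bw_sq_line_le hS hQ (hI r hr))

/-- An admissible piece of the optimal line solves geodesic PCA as soon as its closure contains
the clipped times. -/
theorem IsLiftedSolution.isGPCASolution {ε : ℝ} (hε : 0 ≤ ε)
    {S : Fin n → Matrix (Fin d) (Fin d) ℝ} (hS : ∀ i, (S i).PosDef)
    {A X : Matrix (Fin d) (Fin d) ℝ} {Q : Fin n → Matrix (Fin d) (Fin d) ℝ}
    (hsol : IsLiftedSolution ε S A X Q) {I : Set ℝ} (hne : I.Nonempty) (hoc : I.OrdConnected)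
    (hI : ∀ t ∈ I, t ∈ clipInterval ε A X ∧ IsUnit (A + t • X))
    (hclip : ∀ i, clippedTime ε (S i) A X (Q i) ∈ closure I) :
    IsGPCASolution ε S (fun t => proj (A + t • X)) I := by
  obtain ⟨hA, hX, hX1, hQ, -⟩ := hsol.1
  refine ⟨isAdmissible_line hA hX hX1 hε hne hoc hI, fun γ' I' h' => ?_⟩
  refine le_trans (Finset.sum_le_sum fun i _ => ?_) (hsol.le_gpcaCost hS h')
  exact ciInf_bw_sq_line_le_of_mem_closure hX1 (hS i) (hQ i) (fun t ht => (hI t ht).2) (hclip i)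

end GaussianGPCA

theorem proposition3 {d n : ℕ} (ε : ℝ) (hε : 0 ≤ ε)
    (S : Fin n → Matrix (Fin d) (Fin d) ℝ) (hS : ∀ i, (S i).PosDef)
    (A X : Matrix (Fin d) (Fin d) ℝ) (Q : Fin n → Matrix (Fin d) (Fin d) ℝ)
    (hsol : GaussianGPCA.IsLiftedSolution ε S A X Q) :
    GaussianGPCA.IsGPCASolution ε S (fun t => GaussianGPCA.proj (A + t • X))
        {t | t ∈ GaussianGPCA.clipInterval ε A X ∧ IsUnit (A + t • X)} ∧
      ((0 < ε ∨ ∀ i, IsUnit (A + GaussianGPCA.clippedTime ε (S i) A X (Q i) • X)) →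
        ∃ tmin tmax : ℝ, tmin ≤ tmax ∧
          (∀ t ∈ Set.Icc tmin tmax,
            t ∈ GaussianGPCA.clipInterval ε A X ∧ IsUnit (A + t • X)) ∧
          (∀ i, GaussianGPCA.clippedTime ε (S i) A X (Q i) ∈ Set.Icc tmin tmax) ∧
          GaussianGPCA.IsGPCASolution ε S (fun t => GaussianGPCA.proj (A + t • X))
            (Set.Icc tmin tmax)) := by
  obtain ⟨hA, hX, hX1, hQ, hne⟩ := hsol.1
  have hmem := fun i => GaussianGPCA.clippedTime_mem hne (S i) (Q i)
  have hcl := fun i => GaussianGPCA.mem_closure_regular hε hA hX (hmem i)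
  have hoc := GaussianGPCA.ordConnected_regular hA hX hε
  obtain ⟨t₀, ht₀⟩ : {t | t ∈ GaussianGPCA.clipInterval ε A X ∧ IsUnit (A + t • X)}.Nonempty := by
    obtain ⟨r, hr⟩ := hne
    exact closure_nonempty_iff.1 ⟨r, GaussianGPCA.mem_closure_regular hε hA hX hr⟩
  refine ⟨hsol.isGPCASolution hε hS ⟨t₀, ht₀⟩ hoc (fun _ h => h) hcl, fun hreg => ?_⟩
  have hunit : ∀ i, IsUnit (A + GaussianGPCA.clippedTime ε (S i) A X (Q i) • X) :=
    hreg.elim (fun h i => GaussianGPCA.isUnit_of_mem_clipInterval hA hX h (hmem i)) id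
  -- The extra regular time `t₀` keeps `T` nonempty when `n = 0`.
  set T : Finset ℝ := insert t₀ (Finset.univ.image fun i =>
    GaussianGPCA.clippedTime ε (S i) A X (Q i))
  have hT : T.Nonempty := Finset.insert_nonempty _ _
  have hTmem : ∀ t ∈ T, t ∈ GaussianGPCA.clipInterval ε A X ∧ IsUnit (A + t • X) := by
    intro t ht
    rcases Finset.mem_insert.1 ht with rfl | ht
    · exact ht₀
    · obtain ⟨i, -, rfl⟩ := Finset.mem_image.1 ht
      exact ⟨hmem i, hunit i⟩
  have hle : T.min' hT ≤ T.max' hT := T.min'_le _ (T.max'_mem hT)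
  have hIcc : ∀ t ∈ Set.Icc (T.min' hT) (T.max' hT),
      t ∈ GaussianGPCA.clipInterval ε A X ∧ IsUnit (A + t • X) := fun t ht =>
    hoc.out (hTmem _ (T.min'_mem hT)) (hTmem _ (T.max'_mem hT)) ht
  have hin : ∀ i, GaussianGPCA.clippedTime ε (S i) A X (Q i) ∈
      Set.Icc (T.min' hT) (T.max' hT) := fun i => by
    have : GaussianGPCA.clippedTime ε (S i) A X (Q i) ∈ T :=
      Finset.mem_insert_of_mem (Finset.mem_image_of_mem _ (Finset.mem_univ i))
    exact ⟨T.min'_le _ this, T.le_max' _ this⟩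
  exact ⟨_, _, hle, hIcc, hin, hsol.isGPCASolution hε hS (Set.nonempty_Icc.2 hle)
    Set.ordConnected_Icc hIcc fun i => subset_closure (hin i)⟩
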